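/- Let $(E,d)$ be a complete separable metric space with $d\le 1$, equipped with its Borel $\sigma$-algebra $\mathcal B(E)$, and let $P$ be a Markov kernel on $E$. For a kernel $K$ and a function $f\ge 0$ write $Kf(u)=\int f(v)\,K(u,\mathrm dv)$, and let $K^n$ be the $n$-fold iterate of $K$ ($K^0$ being the identity kernel). Assume the following. (i) There are a coupling kernel $Q$ for $P$ (a Markov kernel on $E\times E$ such that, for all $x,y\in E$, $Q((x,y),\cdot)$ has marginals $P(x,\cdot)$ and $P(y,\cdot)$), a measurable set $\Delta\subseteq E\times E$, an integer $\ell\ge 1$ and $\epsilon>0$ such that $$Qd(x,y)\le d(x,y)\ \text{ for all } x,y\in E,\qquad Q^\ell d(x,y)\le (1-\epsilon)\,d(x,y)\ \text{ for all } (x,y)\in\Delta .$$ (ii) There are a measurable function $\mathcal V:E\times E\to[1,\infty)$ and a constant $0\le b<\infty$ such that $$Q\mathcal V(x,y)\le \mathcal V(x,y)-1+b\,\mathbf 1_\Delta(x,y)\ \text{ for all } x,y\in E,\qquad \sup_{(x,y)\in\Delta}Q^{\ell-1}\mathcal V(x,y)<\infty .$$ (iii) There are a function $\psi:[0,\infty)\to[0,\infty)$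 such that $v\mapsto\psi(v)/v$ is non-increasing on $(0,\infty)$ and $\lim_{v\to\infty}\psi(v)=\infty$, a point $x_0\in E$, and a sequence of non-negative integers $n_k\to\infty$ such that, with $\mathcal V_{x_0}=\mathcal V(x_0,\cdot)$, $$\sup_{k} P^{n_k}[\psi\circ\mathcal V_{x_0}](x_0)<\infty .$$ Then $P$ admits a unique invariant probability measure $\pi$, and there is a constant $C<\infty$ such that for all integers $n\ge 2$ and all $x,y\in E$, $$Q^n d(x,y)\le C\,\frac{\log n}{n}\,\mathcal V(x,y).$$ -/

import Mathlib

open MeasureTheory ProbabilityTheory Filter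
open scoped ENNReal NNReal

/-- `γ` is a coupling of `μ` and `ν`: its two marginals are `μ` and `ν`. -/
def IsCoupling {E : Type*} [MeasurableSpace E] (γ : Measure (E × E)) (μ ν : Measure E) : Prop :=
  γ.map Prod.fst = μ ∧ γ.map Prod.snd = ν

/-- `Q` is a coupling kernel for the Markov kernel `P`: it is a Markov kernel on `E × E` and
`Q((x, y), ·)` is a coupling of `P(x, ·)` and `P(y, ·)` for all `x, y`. -/
structure IsCouplingKernel {E : Type*} [MeasurableSpace E]
    (Q : Kernel (E × E) (E × E)) (P : Kernel E E) : Prop where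
  isMarkov : IsMarkovKernel Q
  isCoupling : ∀ x y : E, IsCoupling (Q (x, y)) (P x) (P y)

/-- The contraction condition for `Q`: `Q d ≤ d` everywhere, and
`Q^ℓ d ≤ (1 - ε) d` on `Δ`, where `d` is the distance of `E`. -/
structure ContractionCondition {E : Type*} [MetricSpace E] [MeasurableSpace E]
    (Q : Kernel (E × E) (E × E)) (Δ : Set (E × E)) (ℓ : ℕ) (ε : ℝ) : Prop where
  weak : ∀ x y : E, ∫ z, dist z.1 z.2 ∂(Q (x, y)) ≤ dist x y
  strict : ∀ x y : E, (x, y) ∈ Δ → ∫ z, dist z.1 z.2 ∂((Q ^ ℓ) (x, y)) ≤ (1 - ε) * dist x y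

/-- The drift condition: `Q 𝒱 ≤ 𝒱 - 1 + b 1_Δ` everywhere, and `sup_Δ Q^(ℓ-1) 𝒱 < ∞`.
It is used for `𝒱 ≥ 1` and `ℓ ≥ 1`, where both truncated subtractions are exact. -/
structure DriftCondition {E : Type*} [MeasurableSpace E]
    (Q : Kernel (E × E) (E × E)) (Δ : Set (E × E)) (ℓ : ℕ) (𝒱 : E × E → ℝ≥0) (b : ℝ≥0) :
    Prop where
  drift : ∀ p : E × E,
    ∫⁻ z, (𝒱 z : ℝ≥0∞) ∂(Q p) ≤ (𝒱 p : ℝ≥0∞) - 1 + Δ.indicator (fun _ => (b : ℝ≥0∞)) p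
  bounded : ⨆ p ∈ Δ, ∫⁻ z, (𝒱 z : ℝ≥0∞) ∂((Q ^ (ℓ - 1)) p) < ∞

/-! With `r = max (1 - ε) (1 / 2)` and `M` a bound for `Q^ℓ 𝒱` on `Δ`, a double induction on `k`
and `m` gives `m * Q^m d ≤ m * r^k * d + 𝒱 + k * (ℓ + M)`: off `Δ`, one step of `Q` raises `m` by
one and lowers `𝒱` by one; on `Δ`, `ℓ` steps trade a factor `r` for the constant `ℓ + M`. The
choice `k = ⌈log m / -log r⌉` yields the rate `log m / m`.

By Markov's inequality the Lévy–Prokhorov distance between two probability measures is at most the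
square root of `∫ d` over any of their couplings, so `Q^m d → 0` forces invariant probability
measures to coincide. Tightness of `𝒱 (x₀, ·)` under `P^(n k) (x₀, ·)` makes `P^m (x₀, ·)` close to
`P^(n k + m) (x₀, ·)` uniformly in `k` for large `m`, while `P^(n k + m) (x₀, ·)` is asymptotically
`P^(n k) (x₀, ·)` for fixed `m`. Hence `P^(n k) (x₀, ·)` is a Cauchy sequence for the
Lévy–Prokhorov metric, which is complete, and its limit is invariant since `P` is Feller. -/

open scoped Topology

section KernelPow

variable {α : Type*} [MeasurableSpace α] {Q : Kernel α α} {f V : α → ℝ≥0∞}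

instance isMarkovKernel_pow [IsMarkovKernel Q] (n : ℕ) : IsMarkovKernel (Q ^ n) := by
  induction n with
  | zero => exact inferInstanceAs (IsMarkovKernel Kernel.id)
  | succ n ih => rw [pow_succ]; exact inferInstanceAs (IsMarkovKernel ((Q ^ n) ∘ₖ Q))

theorem lintegral_kernel_pow_zero (hf : Measurable f) (a : α) :
    ∫⁻ x, f x ∂(Q ^ 0) a = f a :=
  Kernel.lintegral_id' hf a

theorem lintegral_kernel_pow_add (hf : Measurable f) (m n : ℕ) (a : α) :
    ∫⁻ x, f x ∂(Q ^ (m + n)) a = ∫⁻ y, ∫⁻ x, f x ∂(Q ^ n) y ∂(Q ^ m) a := by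
  rw [add_comm, Kernel.pow_add, Kernel.lintegral_comp _ _ _ hf]

theorem lintegral_kernel_pow_le_self (hf : Measurable f) (hQf : ∀ a, ∫⁻ x, f x ∂Q a ≤ f a)
    (n : ℕ) (a : α) : ∫⁻ x, f x ∂(Q ^ n) a ≤ f a := by
  induction n with
  | zero => exact (lintegral_kernel_pow_zero hf a).le
  | succ n ih =>
    rw [lintegral_kernel_pow_add hf, pow_one]
    exact (lintegral_mono hQf).trans ih

theorem tendsto_lintegral_lintegral_kernel_pow (hf : Measurable f)
    (hQf : ∀ a, ∫⁻ x, f x ∂Q a ≤ f a)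
    (hlim : ∀ a, Tendsto (fun n => ∫⁻ x, f x ∂(Q ^ n) a) atTop (𝓝 0))
    {γ : Measure α} (hγ : ∫⁻ x, f x ∂γ ≠ ∞) :
    Tendsto (fun n => ∫⁻ a, ∫⁻ x, f x ∂(Q ^ n) a ∂γ) atTop (𝓝 0) := by
  have h := tendsto_lintegral_of_dominated_convergence (μ := γ) f (fun n => hf.lintegral_kernel)
    (fun n => ae_of_all _ (lintegral_kernel_pow_le_self hf hQf n)) hγ (ae_of_all _ hlim)
  rwa [lintegral_zero] at h

theorem bind_kernel_pow_apply (P : Kernel α α) (m n : ℕ) (a : α) :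
    ((P ^ m) a).bind (P ^ n) = (P ^ (m + n)) a := by
  rw [add_comm, Kernel.pow_add, Kernel.comp_apply]

theorem invariant_kernel_pow {P : Kernel α α} {μ : Measure α} (hμ : Kernel.Invariant P μ) (n : ℕ) :
    Kernel.Invariant (P ^ n) μ := by
  induction n with
  | zero => exact Measure.bind_dirac
  | succ n ih => rw [Kernel.pow_add, pow_one]; exact ih.comp hμ

end KernelPow

section Decay

variable {α : Type*} [MeasurableSpace α] {Q : Kernel α α} [IsMarkovKernel Q] {f V : α → ℝ≥0∞}

theorem add_mul_lintegral_kernel_pow_le (hf : Measurable f) (hf_one : ∀ a, f a ≤ 1)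
    (hV : Measurable V) {m : ℕ} {c e : ℝ≥0∞}
    (h : ∀ a, m * ∫⁻ x, f x ∂(Q ^ m) a ≤ c * f a + V a + e) (j : ℕ) (a : α) :
    (j + m) * ∫⁻ x, f x ∂(Q ^ (j + m)) a ≤
      j + (c * ∫⁻ x, f x ∂(Q ^ j) a + ∫⁻ x, V x ∂(Q ^ j) a + e) := by
  have hone : ∫⁻ x, f x ∂(Q ^ (j + m)) a ≤ 1 := (lintegral_mono hf_one).trans (by simp)
  rw [add_mul]
  refine add_le_add (mul_le_of_le_one_right' hone) ?_
  calc m * ∫⁻ x, f x ∂(Q ^ (j + m)) a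
      = ∫⁻ y, m * ∫⁻ x, f x ∂(Q ^ m) y ∂(Q ^ j) a := by
        rw [lintegral_kernel_pow_add hf, lintegral_const_mul _ hf.lintegral_kernel]
    _ ≤ ∫⁻ y, (c * f y + V y + e) ∂(Q ^ j) a := lintegral_mono h
    _ = c * ∫⁻ x, f x ∂(Q ^ j) a + ∫⁻ x, V x ∂(Q ^ j) a + e := by
        rw [lintegral_add_right _ measurable_const, lintegral_add_right _ hV,
          lintegral_const_mul _ hf, lintegral_const, measure_univ, mul_one]

variable {Δ : Set α} {ℓ : ℕ} {r M : ℝ≥0∞}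

theorem succ_mul_lintegral_kernel_pow_le_of_drift (hf : Measurable f) (hf_one : ∀ a, f a ≤ 1)
    (hV : Measurable V) {n k : ℕ} {e : ℝ≥0∞}
    (h : ∀ a, n * ∫⁻ x, f x ∂(Q ^ n) a ≤ n * r ^ k * f a + V a + e) {a : α}
    (hQf : ∫⁻ x, f x ∂Q a ≤ f a) (hQV : ∫⁻ x, V x ∂Q a + 1 ≤ V a) :
    (n + 1 : ℕ) * ∫⁻ x, f x ∂(Q ^ (n + 1)) a ≤ (n + 1 : ℕ) * r ^ k * f a + V a + e := by
  have hstep := add_mul_lintegral_kernel_pow_le hf hf_one hV h 1 a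
  rw [add_comm 1 n, pow_one, Nat.cast_one, add_comm 1 (n : ℝ≥0∞)] at hstep
  rw [Nat.cast_succ]
  calc (n + 1) * ∫⁻ x, f x ∂(Q ^ (n + 1)) a
      ≤ 1 + (n * r ^ k * ∫⁻ x, f x ∂Q a + ∫⁻ x, V x ∂Q a + e) := hstep
    _ = n * r ^ k * ∫⁻ x, f x ∂Q a + (∫⁻ x, V x ∂Q a + 1) + e := by ring
    _ ≤ (n + 1) * r ^ k * f a + V a + e := by gcongr; exact le_self_add

theorem mul_lintegral_kernel_pow_le_of_contraction (hf : Measurable f) (hf_one : ∀ a, f a ≤ 1)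
    (hV : Measurable V) {k : ℕ} {e : ℝ≥0∞}
    (h : ∀ n : ℕ, ∀ a, n * ∫⁻ x, f x ∂(Q ^ n) a ≤ n * r ^ k * f a + V a + e) (n : ℕ) {a : α}
    (hQf : ∫⁻ x, f x ∂(Q ^ ℓ) a ≤ r * f a) (hQV : ∫⁻ x, V x ∂(Q ^ ℓ) a ≤ M) :
    n * ∫⁻ x, f x ∂(Q ^ n) a ≤ n * r ^ (k + 1) * f a + (e + (ℓ + M)) := by
  rcases le_total n ℓ with hn | hn
  · calc n * ∫⁻ x, f x ∂(Q ^ n) a ≤ n :=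
          mul_le_of_le_one_right' ((lintegral_mono hf_one).trans (by simp))
      _ ≤ ℓ := by exact_mod_cast hn
      _ ≤ n * r ^ (k + 1) * f a + (e + (ℓ + M)) :=
          le_self_add.trans (le_add_self.trans le_add_self)
  · obtain ⟨m, rfl⟩ := Nat.exists_eq_add_of_le hn
    push_cast
    calc (ℓ + m) * ∫⁻ x, f x ∂(Q ^ (ℓ + m)) a
        ≤ ℓ + (m * r ^ k * ∫⁻ x, f x ∂(Q ^ ℓ) a + ∫⁻ x, V x ∂(Q ^ ℓ) a + e) :=
          add_mul_lintegral_kernel_pow_le hf hf_one hV (h m) ℓ a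
      _ ≤ ℓ + (m * r ^ k * (r * f a) + M + e) := by gcongr
      _ = m * r ^ (k + 1) * f a + (e + (ℓ + M)) := by ring
      _ ≤ (ℓ + m) * r ^ (k + 1) * f a + (e + (ℓ + M)) := by gcongr; exact le_add_self

theorem mul_lintegral_kernel_pow_le (hf : Measurable f) (hf_one : ∀ a, f a ≤ 1)
    (hQf : ∀ a, ∫⁻ x, f x ∂Q a ≤ f a) (hQf_Δ : ∀ a ∈ Δ, ∫⁻ x, f x ∂(Q ^ ℓ) a ≤ r * f a)
    (hV : Measurable V) (hQV : ∀ a ∉ Δ, ∫⁻ x, V x ∂Q a + 1 ≤ V a)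
    (hQV_Δ : ∀ a ∈ Δ, ∫⁻ x, V x ∂(Q ^ ℓ) a ≤ M) (k n : ℕ) (a : α) :
    n * ∫⁻ x, f x ∂(Q ^ n) a ≤ n * r ^ k * f a + V a + k * (ℓ + M) := by
  induction k generalizing n a with
  | zero =>
    rw [pow_zero, mul_one, add_assoc]
    exact le_add_right (mul_le_mul_right (lintegral_kernel_pow_le_self hf hQf n a) _)
  | succ k ihk =>
    induction n generalizing a with
    | zero => simp
    | succ n ihn =>
      by_cases ha : a ∈ Δ
      · have h := mul_lintegral_kernel_pow_le_of_contraction hf hf_one hV ihk (n + 1)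
          (hQf_Δ a ha) (hQV_Δ a ha)
        rw [Nat.cast_succ k, add_one_mul]
        exact h.trans (add_le_add_left le_self_add _)
      · exact succ_mul_lintegral_kernel_pow_le_of_drift hf hf_one hV ihn (hQf a) (hQV a ha)

end Decay

section Rate

theorem mul_pow_ceil_log_div_neg_log_le_one {r t : ℝ} (hr0 : 0 < r) (hr1 : r < 1) (ht : 0 < t) :
    t * r ^ ⌈Real.log t / -Real.log r⌉₊ ≤ 1 := by
  have hk := Nat.le_ceil (Real.log t / -Real.log r)
  rw [div_le_iff₀ (neg_pos.2 (Real.log_neg hr0 hr1))] at hk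
  rw [← Real.log_nonpos_iff (by positivity), Real.log_mul ht.ne' (by positivity), Real.log_pow]
  linarith

theorem exists_le_mul_log_div_of_forall_mul_le {r B : ℝ} (hr0 : 0 < r) (hr1 : r < 1)
    (hB : 0 ≤ B) :
    ∃ C : ℝ, ∀ n : ℕ, 2 ≤ n → ∀ v : ℝ, 1 ≤ v → ∀ a : ℝ,
      (∀ k : ℕ, n * a ≤ n * r ^ k + v + k * B) → a ≤ C * (Real.log n / n) * v := by
  have hr : 0 < -Real.log r := neg_pos.2 (Real.log_neg hr0 hr1)
  have hlog2 : 0 < Real.log 2 := Real.log_pos one_lt_two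
  refine ⟨(2 + B) / Real.log 2 + B / -Real.log r, fun n hn v hv a ha => ?_⟩
  have hn0 : (0 : ℝ) < n := by exact_mod_cast (by omega : 0 < n)
  have hlog : Real.log 2 ≤ Real.log n := Real.log_le_log two_pos (by exact_mod_cast hn)
  have hlog0 : 0 ≤ Real.log n := hlog2.le.trans hlog
  have hconst : 2 + B ≤ (2 + B) / Real.log 2 * Real.log n := by
    rw [div_mul_eq_mul_div, le_div_iff₀ hlog2]
    gcongr
  have hceil := (Nat.ceil_lt_add_one (div_nonneg hlog0 hr.le)).le
  have hna := calc
    n * a ≤ n * r ^ ⌈Real.log n / -Real.log r⌉₊ + v + ⌈Real.log n / -Real.log r⌉₊ * B := ha _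
    _ ≤ 1 + v + (Real.log n / -Real.log r + 1) * B := by
      gcongr
      exact mul_pow_ceil_log_div_neg_log_le_one hr0 hr1 hn0
    _ = 1 + v + (B + B / -Real.log r * Real.log n) := by ring
    _ ≤ v + v + (B + B / -Real.log r * Real.log n) * v := by
      gcongr
      exact le_mul_of_one_le_right (by positivity) hv
    _ = (2 + B + B / -Real.log r * Real.log n) * v := by ring
    _ ≤ ((2 + B) / Real.log 2 * Real.log n + B / -Real.log r * Real.log n) * v := by gcongr
  calc a ≤ ((2 + B) / Real.log 2 * Real.log n + B / -Real.log r * Real.log n) * v / n := by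
        rwa [le_div_iff₀' hn0]
    _ = ((2 + B) / Real.log 2 + B / -Real.log r) * (Real.log n / n) * v := by ring

end Rate

section Conditions

theorem integral_dist_eq_toReal_lintegral_edist {E : Type*} [PseudoMetricSpace E]
    [SecondCountableTopology E] [MeasurableSpace E] [OpensMeasurableSpace E]
    (μ : Measure (E × E)) : ∫ z, dist z.1 z.2 ∂μ = (∫⁻ z, edist z.1 z.2 ∂μ).toReal := by
  simp_rw [edist_dist]
  exact integral_eq_lintegral_of_nonneg_ae (ae_of_all _ fun _ => dist_nonneg)
    measurable_dist.aestronglyMeasurable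

theorem ofReal_integral_dist {E : Type*} [PseudoMetricSpace E] [SecondCountableTopology E]
    [MeasurableSpace E] [OpensMeasurableSpace E] (hd : ∀ x y : E, dist x y ≤ 1)
    (μ : Measure (E × E)) [IsFiniteMeasure μ] :
    ENNReal.ofReal (∫ z, dist z.1 z.2 ∂μ) = ∫⁻ z, edist z.1 z.2 ∂μ := by
  have hedist (z : E × E) : edist z.1 z.2 ≤ 1 := by simpa [edist_dist] using hd z.1 z.2
  have hfin : ∫⁻ z, edist z.1 z.2 ∂μ ≠ ∞ :=
    ((lintegral_mono hedist).trans_lt (lintegral_const_lt_top ENNReal.one_ne_top)).ne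
  rw [integral_dist_eq_toReal_lintegral_edist, ENNReal.ofReal_toReal hfin]

theorem DriftCondition.lintegral_add_one_le {E : Type*} [MeasurableSpace E]
    {Q : Kernel (E × E) (E × E)} {Δ : Set (E × E)} {ℓ : ℕ} {𝒱 : E × E → ℝ≥0} {b : ℝ≥0}
    (h : DriftCondition Q Δ ℓ 𝒱 b) {p : E × E} (hp : p ∉ Δ) (h𝒱p : 1 ≤ 𝒱 p) :
    ∫⁻ z, 𝒱 z ∂Q p + 1 ≤ 𝒱 p := by
  have hdrift := h.drift p
  rw [Set.indicator_of_notMem hp, add_zero] at hdrift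
  calc ∫⁻ z, 𝒱 z ∂Q p + 1 ≤ (𝒱 p - 1 : ℝ≥0∞) + 1 := by gcongr
    _ = 𝒱 p := tsub_add_cancel_of_le (by exact_mod_cast h𝒱p)

theorem DriftCondition.exists_lintegral_pow_le {E : Type*} [MeasurableSpace E]
    {Q : Kernel (E × E) (E × E)} [IsMarkovKernel Q] {Δ : Set (E × E)} {ℓ : ℕ} {𝒱 : E × E → ℝ≥0}
    {b : ℝ≥0} (h : DriftCondition Q Δ ℓ 𝒱 b) (hℓ : 1 ≤ ℓ) (h𝒱 : Measurable 𝒱) :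
    ∃ M : ℝ≥0, ∀ p ∈ Δ, ∫⁻ z, 𝒱 z ∂(Q ^ ℓ) p ≤ M := by
  lift ⨆ p ∈ Δ, ∫⁻ z, (𝒱 z : ℝ≥0∞) ∂(Q ^ (ℓ - 1)) p to ℝ≥0 using h.bounded.ne with S hS
  have hstep (q : E × E) : ∫⁻ z, 𝒱 z ∂Q q ≤ 𝒱 q + b :=
    (h.drift q).trans (add_le_add tsub_le_self (Set.indicator_le_self' (fun _ _ => zero_le) q))
  refine ⟨S + b, fun p hp => ?_⟩
  calc ∫⁻ z, 𝒱 z ∂(Q ^ ℓ) p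
      = ∫⁻ y, ∫⁻ z, 𝒱 z ∂Q y ∂(Q ^ (ℓ - 1)) p := by
        conv_lhs => rw [← Nat.sub_add_cancel hℓ]
        rw [lintegral_kernel_pow_add h𝒱.coe_nnreal_ennreal, pow_one]
    _ ≤ ∫⁻ y, (𝒱 y + b : ℝ≥0∞) ∂(Q ^ (ℓ - 1)) p := lintegral_mono hstep
    _ = ∫⁻ y, 𝒱 y ∂(Q ^ (ℓ - 1)) p + b := by
        rw [lintegral_add_right _ measurable_const, lintegral_const, measure_univ, mul_one]
    _ ≤ (S + b : ℝ≥0) := by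
        rw [ENNReal.coe_add, hS]
        gcongr
        exact le_iSup₂ (f := fun p (_ : p ∈ Δ) => ∫⁻ z, (𝒱 z : ℝ≥0∞) ∂(Q ^ (ℓ - 1)) p) p hp

variable {E : Type*} [MetricSpace E] [SecondCountableTopology E] [MeasurableSpace E]
  [OpensMeasurableSpace E] {Q : Kernel (E × E) (E × E)} [IsMarkovKernel Q]
  {Δ : Set (E × E)} {ℓ : ℕ} {ε : ℝ}

theorem ContractionCondition.lintegral_edist_le (h : ContractionCondition Q Δ ℓ ε)
    (hd : ∀ x y : E, dist x y ≤ 1) (p : E × E) :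
    ∫⁻ z, edist z.1 z.2 ∂Q p ≤ edist p.1 p.2 := by
  rw [← ofReal_integral_dist hd, edist_dist]
  exact ENNReal.ofReal_le_ofReal (h.weak p.1 p.2)

theorem ContractionCondition.lintegral_edist_pow_le (h : ContractionCondition Q Δ ℓ ε)
    (hd : ∀ x y : E, dist x y ≤ 1) {p : E × E} (hp : p ∈ Δ) :
    ∫⁻ z, edist z.1 z.2 ∂(Q ^ ℓ) p ≤ ENNReal.ofReal (1 - ε) * edist p.1 p.2 := by
  rw [← ofReal_integral_dist hd, edist_dist, ← ENNReal.ofReal_mul' dist_nonneg]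
  exact ENNReal.ofReal_le_ofReal (h.strict p.1 p.2 hp)

theorem exists_integral_dist_pow_le (hd : ∀ x y : E, dist x y ≤ 1) (hℓ : 1 ≤ ℓ) (hε : 0 < ε)
    (hcontr : ContractionCondition Q Δ ℓ ε) {𝒱 : E × E → ℝ≥0} (h𝒱 : Measurable 𝒱)
    (h𝒱_one : ∀ p, 1 ≤ 𝒱 p) {b : ℝ≥0} (hdrift : DriftCondition Q Δ ℓ 𝒱 b) :
    ∃ C : ℝ, ∀ m : ℕ, 2 ≤ m → ∀ p : E × E,
      ∫ z, dist z.1 z.2 ∂(Q ^ m) p ≤ C * (Real.log m / m) * 𝒱 p := by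
  obtain ⟨M, hM⟩ := hdrift.exists_lintegral_pow_le hℓ h𝒱
  let r : ℝ≥0 := max (1 - ε).toNNReal (1 / 2)
  have hr : (1 - ε).toNNReal ≤ r := le_max_left _ _
  have hr0 : 0 < r := lt_max_of_lt_right (by norm_num)
  have hr1 : r < 1 := max_lt (by simpa using hε) (by norm_num)
  have hedist (p : E × E) : edist p.1 p.2 ≤ 1 := by simpa [edist_dist] using hd p.1 p.2
  have hdecay (k m : ℕ) (p : E × E) :
      m * ∫ z, dist z.1 z.2 ∂(Q ^ m) p ≤ m * (r : ℝ) ^ k + 𝒱 p + k * (ℓ + M) := by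
    rw [integral_dist_eq_toReal_lintegral_edist, ← ENNReal.toReal_natCast, ← ENNReal.toReal_mul]
    refine ENNReal.toReal_le_coe_of_le_coe
      (b := m * r ^ k + 𝒱 p + k * (ℓ + M)) ?_
    have h := mul_lintegral_kernel_pow_le measurable_edist hedist (hcontr.lintegral_edist_le hd)
      (fun q hq => (hcontr.lintegral_edist_pow_le hd hq).trans
        (mul_le_mul_left (ENNReal.coe_le_coe.2 hr) _))
      h𝒱.coe_nnreal_ennreal (fun q hq => hdrift.lintegral_add_one_le hq (h𝒱_one q)) hM k m p
    push_cast
    refine h.trans ?_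
    gcongr ?_ + _ + _
    exact mul_le_of_le_one_right' (hedist p)
  obtain ⟨C, hC⟩ := exists_le_mul_log_div_of_forall_mul_le (r := r) (B := ℓ + M) hr0 hr1
    (by positivity)
  exact ⟨C, fun m hm p => hC m hm _ (h𝒱_one p) _ fun k => hdecay k m p⟩

end Conditions

section Coupling

theorem map_bind_eq_bind_map {α α' β β' : Type*} [MeasurableSpace α] [MeasurableSpace α']
    [MeasurableSpace β] [MeasurableSpace β'] {Q : Kernel α α'} {P : Kernel β β'} {f : α → β}
    {g : α' → β'} (hf : Measurable f) (hg : Measurable g) (h : ∀ a, (Q a).map g = P (f a))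
    (μ : Measure α) : (μ.bind Q).map g = (μ.map f).bind P := by
  ext s hs
  rw [Measure.map_apply hg hs, Measure.bind_apply (hg hs) Q.aemeasurable,
    Measure.bind_apply hs P.aemeasurable, lintegral_map (P.measurable_coe hs) hf]
  simp_rw [← h, Measure.map_apply hg hs]

section Measurable

variable {E : Type*} [MeasurableSpace E] {μ ν : Measure E} {γ : Measure (E × E)}
  {P : Kernel E E} {Q : Kernel (E × E) (E × E)}

theorem isCoupling_prod (μ ν : Measure E) [IsProbabilityMeasure μ] [IsProbabilityMeasure ν] :
    IsCoupling (μ.prod ν) μ ν :=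
  ⟨Measure.fst_prod, Measure.snd_prod⟩

theorem IsCoupling.bind (hγ : IsCoupling γ μ ν) (hQ : IsCouplingKernel Q P) :
    IsCoupling (γ.bind Q) (μ.bind P) (ν.bind P) := by
  constructor
  · rw [← hγ.1]
    exact map_bind_eq_bind_map measurable_fst measurable_fst
      (fun p => (hQ.isCoupling p.1 p.2).1) γ
  · rw [← hγ.2]
    exact map_bind_eq_bind_map measurable_snd measurable_snd
      (fun p => (hQ.isCoupling p.1 p.2).2) γ

theorem IsCouplingKernel.pow (hQ : IsCouplingKernel Q P) (m : ℕ) :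
    IsCouplingKernel (Q ^ m) (P ^ m) where
  isMarkov := have := hQ.isMarkov; isMarkovKernel_pow m
  isCoupling x y := by
    induction m with
    | zero => exact ⟨Measure.map_dirac' measurable_fst _, Measure.map_dirac' measurable_snd _⟩
    | succ m ih =>
      rw [← bind_kernel_pow_apply, ← bind_kernel_pow_apply, ← bind_kernel_pow_apply]
      simp only [pow_one]
      exact ih.bind hQ

end Measurable

variable {E : Type*} [PseudoEMetricSpace E] [SecondCountableTopology E] [MeasurableSpace E]
  [OpensMeasurableSpace E] {μ ν : Measure E} {γ : Measure (E × E)}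

theorem IsCoupling.measure_le_measure_thickening_add (hγ : IsCoupling γ μ ν) {ε : ℝ≥0∞}
    (hε0 : ε ≠ 0) (hε : ε ≠ ∞) {B : Set E} (hB : MeasurableSet B) :
    μ B ≤ ν (Metric.thickening ε.toReal B) + (∫⁻ z, edist z.1 z.2 ∂γ) / ε := by
  have hsub : Prod.fst ⁻¹' B ⊆
      Prod.snd ⁻¹' Metric.thickening ε.toReal B ∪ {z : E × E | ε ≤ edist z.1 z.2} := by
    intro z hz
    rcases le_or_gt ε (edist z.1 z.2) with h | h
    · exact Or.inr h
    · refine Or.inl ((Metric.mem_thickening_iff_exists_edist_lt _ _).2 ⟨z.1, hz, ?_⟩)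
      rwa [ENNReal.ofReal_toReal hε, edist_comm]
  rw [← hγ.1, ← hγ.2, Measure.map_apply measurable_fst hB,
    Measure.map_apply measurable_snd Metric.isOpen_thickening.measurableSet]
  calc γ (Prod.fst ⁻¹' B)
      ≤ γ (Prod.snd ⁻¹' Metric.thickening ε.toReal B) + γ {z | ε ≤ edist z.1 z.2} :=
        (measure_mono hsub).trans (measure_union_le _ _)
    _ ≤ γ (Prod.snd ⁻¹' Metric.thickening ε.toReal B) + (∫⁻ z, edist z.1 z.2 ∂γ) / ε := by
        gcongr
        exact meas_ge_le_lintegral_div measurable_edist.aemeasurable hε0 hε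

variable [IsProbabilityMeasure μ] [IsProbabilityMeasure ν]

theorem IsCoupling.levyProkhorovEDist_le (hγ : IsCoupling γ μ ν) :
    levyProkhorovEDist μ ν ≤ (∫⁻ z, edist z.1 z.2 ∂γ) ^ (1 / 2 : ℝ) := by
  refine levyProkhorovEDist_le_of_forall_le μ ν _ fun ε B hlt hε hB => ?_
  have hε0 : ε ≠ 0 := (zero_le.trans_lt hlt).ne'
  have hsq : ∫⁻ z, edist z.1 z.2 ∂γ ≤ ε * ε := by
    rw [← sq, ← ENNReal.rpow_natCast, ← ENNReal.rpow_inv_le_iff (by norm_num)]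
    simpa using hlt.le
  refine (hγ.measure_le_measure_thickening_add hε0 hε.ne hB).trans ?_
  gcongr
  exact ENNReal.div_le_of_le_mul hsq

variable {P : Kernel E E} [IsMarkovKernel P] {Q : Kernel (E × E) (E × E)}

theorem IsCouplingKernel.levyProkhorovEDist_bind_le (hQ : IsCouplingKernel Q P)
    (hγ : IsCoupling γ μ ν) :
    levyProkhorovEDist (μ.bind P) (ν.bind P) ≤
      (∫⁻ p, ∫⁻ z, edist z.1 z.2 ∂Q p ∂γ) ^ (1 / 2 : ℝ) := by
  rw [← Measure.lintegral_bind Q.aemeasurable measurable_edist.aemeasurable]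
  exact (hγ.bind hQ).levyProkhorovEDist_le

theorem IsCouplingKernel.levyProkhorovEDist_pow_le (hQ : IsCouplingKernel Q P) (m j : ℕ) (x : E) :
    levyProkhorovEDist ((P ^ m) x) ((P ^ (j + m)) x) ≤
      (∫⁻ y, ∫⁻ z, edist z.1 z.2 ∂(Q ^ m) (x, y) ∂(P ^ j) x) ^ (1 / 2 : ℝ) := by
  have h := (hQ.pow m).levyProkhorovEDist_bind_le (isCoupling_prod (.dirac x) ((P ^ j) x))
  rwa [Measure.dirac_bind (P ^ m).measurable, bind_kernel_pow_apply, Measure.dirac_prod,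
    lintegral_map measurable_edist.lintegral_kernel measurable_prodMk_left] at h

theorem IsCouplingKernel.tendsto_levyProkhorovEDist_pow (hQ : IsCouplingKernel Q P)
    (hcontr : ∀ p, ∫⁻ z, edist z.1 z.2 ∂Q p ≤ edist p.1 p.2)
    (hlim : ∀ p, Tendsto (fun m => ∫⁻ z, edist z.1 z.2 ∂(Q ^ m) p) atTop (𝓝 0))
    {x : E} {j : ℕ} (hfin : ∫⁻ y, edist x y ∂(P ^ j) x ≠ ∞) :
    Tendsto (fun m => levyProkhorovEDist ((P ^ m) x) ((P ^ (j + m)) x)) atTop (𝓝 0) := by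
  have h := tendsto_lintegral_lintegral_kernel_pow (γ := ((P ^ j) x).map (Prod.mk x))
    measurable_edist hcontr hlim (by rwa [lintegral_map measurable_edist measurable_prodMk_left])
  simp_rw [lintegral_map measurable_edist.lintegral_kernel measurable_prodMk_left] at h
  exact tendsto_of_tendsto_of_tendsto_of_le_of_le tendsto_const_nhds
    (by simpa using h.ennrpow_const (1 / 2)) (fun _ => zero_le)
    fun m => hQ.levyProkhorovEDist_pow_le m j x

end Coupling

section Completeness

theorem isCompact_iInter_cthickening {E : Type*} [PseudoMetricSpace E] [CompleteSpace E] {u : ℕ → ℝ}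
    (hu : Tendsto u atTop (𝓝 0)) {K : ℕ → Set E} (hK : ∀ m, IsCompact (K m)) :
    IsCompact (⋂ m, Metric.cthickening (u m) (K m)) := by
  refine TotallyBounded.isCompact_of_isClosed ?_
    (isClosed_iInter fun _ => Metric.isClosed_cthickening)
  refine Metric.totallyBounded_iff.2 fun δ hδ => ?_
  obtain ⟨m, hm⟩ := (hu.eventually_lt_const (half_pos hδ)).exists
  obtain ⟨t, ht_fin, ht⟩ := Metric.totallyBounded_iff.1 (hK m).totallyBounded _ (half_pos hδ)
  refine ⟨t, ht_fin, fun x hx => ?_⟩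
  obtain ⟨y, hyK, hxy⟩ := Metric.mem_thickening_iff.1
    (Metric.cthickening_subset_thickening' (half_pos hδ) hm _ (Set.mem_iInter.1 hx m))
  obtain ⟨z, hz, hyz⟩ := Set.mem_iUnion₂.1 (ht hyK)
  refine Set.mem_iUnion₂.2 ⟨z, hz, ?_⟩
  rw [Metric.mem_ball] at hyz ⊢
  linarith [dist_triangle x y z]

variable {E : Type*} [MeasurableSpace E]

theorem isTightMeasureSet_of_forall_cthickening [PseudoMetricSpace E] [CompleteSpace E]
    {S : Set (Measure E)}
    (h : ∀ η : ℝ, 0 < η → ∀ ε : ℝ≥0∞, 0 < ε →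
      ∃ K : Set E, IsCompact K ∧ ∀ μ ∈ S, μ (Metric.cthickening η K)ᶜ ≤ ε) :
    IsTightMeasureSet S := by
  rw [isTightMeasureSet_iff_exists_isCompact_measure_compl_le]
  intro ε hε
  obtain ⟨ε', hε'_pos, hε'_sum⟩ := ENNReal.exists_pos_sum_of_countable' hε.ne' ℕ
  obtain ⟨u, -, hu_pos, hu⟩ := exists_seq_strictAnti_tendsto (0 : ℝ)
  choose K hK_comp hK using fun m => h (u m) (hu_pos m) (ε' m) (hε'_pos m)
  refine ⟨⋂ m, Metric.cthickening (u m) (K m), isCompact_iInter_cthickening hu hK_comp,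
    fun μ hμ => ?_⟩
  rw [Set.compl_iInter]
  calc μ (⋃ m, (Metric.cthickening (u m) (K m))ᶜ)
      ≤ ∑' m, μ (Metric.cthickening (u m) (K m))ᶜ := measure_iUnion_le _
    _ ≤ ∑' m, ε' m := ENNReal.tsum_le_tsum fun m => hK m μ hμ
    _ ≤ ε := hε'_sum.le

theorem measure_compl_cthickening_le_of_levyProkhorovEDist_lt [PseudoEMetricSpace E]
    [OpensMeasurableSpace E] {μ ν : Measure E} {c : ℝ≥0∞} (h : levyProkhorovEDist μ ν < c)
    {η : ℝ} (hc : c.toReal ≤ η) (K : Set E) :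
    μ (Metric.cthickening η K)ᶜ ≤ ν Kᶜ + c := by
  refine (left_measure_le_of_levyProkhorovEDist_lt h
    Metric.isClosed_cthickening.measurableSet.compl).trans ?_
  gcongr
  intro x hx hxK
  obtain ⟨y, hy, hxy⟩ := (Metric.mem_thickening_iff_exists_edist_lt _ _).1 hx
  refine hy (Metric.thickening_subset_cthickening η K
    ((Metric.mem_thickening_iff_exists_edist_lt _ _).2 ⟨x, hxK, ?_⟩))
  rw [edist_comm]
  exact hxy.trans_le (ENNReal.ofReal_le_ofReal hc)

theorem isTightMeasureSet_of_totallyBounded [PseudoMetricSpace E] [CompleteSpace E]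
    [SecondCountableTopology E] [OpensMeasurableSpace E]
    {S : Set (LevyProkhorov (ProbabilityMeasure E))} (hS : TotallyBounded S) :
    IsTightMeasureSet ((fun μ => (μ.toMeasure : Measure E)) '' S) := by
  refine isTightMeasureSet_of_forall_cthickening fun η hη ε hε => ?_
  let c := min (ENNReal.ofReal η) (ε / 2)
  have hc : 0 < c := lt_min (ENNReal.ofReal_pos.2 hη) (ENNReal.half_pos hε.ne')
  have hcη : c.toReal ≤ η := ENNReal.toReal_le_of_le_ofReal hη.le (min_le_left _ _)
  obtain ⟨t, ht_fin, hSt⟩ := EMetric.totallyBounded_iff.1 hS c hc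
  have ht_tight : IsTightMeasureSet {((μ : ProbabilityMeasure E) : Measure E) |
      μ ∈ LevyProkhorov.toMeasure '' t} :=
    isTightMeasureSet_of_isCompact_closure (ht_fin.image _).isCompact.closure
  obtain ⟨K, hK, htK⟩ := isTightMeasureSet_iff_exists_isCompact_measure_compl_le.1 ht_tight
    (ε / 2) (ENNReal.half_pos hε.ne')
  refine ⟨K, hK, ?_⟩
  rintro _ ⟨μ, hμ, rfl⟩
  obtain ⟨ν, hν, hμν⟩ := Set.mem_iUnion₂.1 (hSt hμ)
  rw [Metric.mem_eball, LevyProkhorov.edist_probabilityMeasure_def] at hμν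
  calc (μ.toMeasure : Measure E) (Metric.cthickening η K)ᶜ
      ≤ (ν.toMeasure : Measure E) Kᶜ + c :=
        measure_compl_cthickening_le_of_levyProkhorovEDist_lt hμν hcη K
    _ ≤ ε / 2 + ε / 2 :=
        add_le_add (htK _ ⟨_, Set.mem_image_of_mem _ hν, rfl⟩) (min_le_right _ _)
    _ = ε := ENNReal.add_halves ε

instance completeSpace_levyProkhorov_probabilityMeasure [MetricSpace E] [CompleteSpace E]
    [SecondCountableTopology E] [BorelSpace E] :
    CompleteSpace (LevyProkhorov (ProbabilityMeasure E)) := by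
  refine Metric.complete_of_cauchySeq_tendsto fun μ hμ => ?_
  have htight := isTightMeasureSet_of_totallyBounded hμ.totallyBounded_range
  have hcompact : IsCompact (closure (Set.range fun k => (μ k).toMeasure)) := by
    refine isCompact_closure_of_isTightMeasureSet (htight.subset ?_)
    rintro _ ⟨_, ⟨k, rfl⟩, rfl⟩
    exact ⟨μ k, ⟨k, rfl⟩, rfl⟩
  obtain ⟨π, -, φ, hφ, hlim⟩ :=
    hcompact.isSeqCompact fun k => subset_closure (Set.mem_range_self k)
  exact ⟨.ofMeasure π, tendsto_nhds_of_cauchySeq_of_subseq hμ hφ.tendsto_atTop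
    ((LevyProkhorov.continuous_ofMeasure_probabilityMeasure.tendsto π).comp hlim)⟩

end Completeness

section Tightness

variable {α ι : Type*} [MeasurableSpace α] {V : α → ℝ≥0} {ν : ι → Measure α}

theorem exists_forall_measure_lt_le_of_iSup_lintegral_lt_top (hV : Measurable V)
    {ψ : ℝ≥0 → ℝ≥0} (hψ : Tendsto ψ atTop atTop) (hbdd : ⨆ i, ∫⁻ a, ψ (V a) ∂ν i < ∞)
    {δ : ℝ≥0∞} (hδ : 0 < δ) : ∃ R : ℝ≥0, ∀ i, ν i {a | R < V a} ≤ δ := by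
  lift ⨆ i, ∫⁻ a, (ψ (V a) : ℝ≥0∞) ∂ν i to ℝ≥0 using hbdd.ne with S hS
  obtain ⟨N, hN⟩ := ENNReal.exists_nat_mul_gt hδ.ne' (ENNReal.coe_ne_top (r := S))
  have hN0 : (N : ℝ≥0∞) ≠ 0 := by rintro h; simp [h] at hN
  obtain ⟨R, hR⟩ := eventually_atTop.1 (hψ.eventually_ge_atTop (N : ℝ≥0))
  refine ⟨R, fun i => ?_⟩
  have hmarkov : N * ν i {a | R < V a} ≤ N * δ := calc
    (N : ℝ≥0∞) * ν i {a | R < V a} = ∫⁻ _ in {a | R < V a}, N ∂ν i :=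
        (setLIntegral_const _ _).symm
    _ ≤ ∫⁻ a in {a | R < V a}, ψ (V a) ∂ν i :=
        setLIntegral_mono' (measurableSet_lt measurable_const hV) fun a (ha : R < V a) => by
          exact_mod_cast hR (V a) ha.le
    _ ≤ ∫⁻ a, ψ (V a) ∂ν i := setLIntegral_le_lintegral _ _
    _ ≤ S := hS ▸ le_iSup (fun i => ∫⁻ a, (ψ (V a) : ℝ≥0∞) ∂ν i) i
    _ ≤ N * δ := hN.le
  exact (ENNReal.mul_le_mul_iff_right hN0 (ENNReal.natCast_ne_top N)).1 hmarkov

theorem tendsto_iSup_lintegral_of_le_mul [∀ i, IsProbabilityMeasure (ν i)] (hV : Measurable V)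
    (htight : ∀ δ : ℝ≥0∞, 0 < δ → ∃ R : ℝ≥0, ∀ i, ν i {a | R < V a} ≤ δ)
    {g : ℕ → α → ℝ≥0∞} (hg : ∀ m a, g m a ≤ 1) {c : ℕ → ℝ≥0∞} (hc : Tendsto c atTop (𝓝 0))
    (hgV : ∀ᶠ m in atTop, ∀ a, g m a ≤ c m * V a) :
    Tendsto (fun m => ⨆ i, ∫⁻ a, g m a ∂ν i) atTop (𝓝 0) := by
  refine ENNReal.tendsto_nhds_zero.2 fun δ hδ => ?_
  obtain ⟨R, hR⟩ := htight (δ / 2) (ENNReal.half_pos hδ.ne')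
  have hcR : Tendsto (fun m => c m * R) atTop (𝓝 0) := by
    simpa using ENNReal.Tendsto.mul_const hc (Or.inr (ENNReal.coe_ne_top (r := R)))
  filter_upwards [hgV, ENNReal.tendsto_nhds_zero.1 hcR _ (ENNReal.half_pos hδ.ne')] with m hm hmR
  refine iSup_le fun i => ?_
  have hsplit (a : α) : g m a ≤ {a | R < V a}.indicator 1 a + c m * R := by
    by_cases ha : R < V a
    · exact (hg m a).trans (le_add_right (by simp [ha]))
    · refine (hm a).trans (le_add_left ?_)
      gcongr
      exact not_lt.1 ha
  calc ∫⁻ a, g m a ∂ν i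
      ≤ ∫⁻ a, ({a | R < V a}.indicator 1 a + c m * R) ∂ν i := lintegral_mono hsplit
    _ = ν i {a | R < V a} + c m * R := by
        rw [lintegral_add_right _ measurable_const, lintegral_const, measure_univ, mul_one,
          lintegral_indicator_one (measurableSet_lt measurable_const hV)]
    _ ≤ δ / 2 + δ / 2 := add_le_add (hR i) hmR
    _ = δ := ENNReal.add_halves δ

end Tightness

section Feller

theorem continuous_bind_of_continuous {α β : Type*} [TopologicalSpace α] [MeasurableSpace α]
    [OpensMeasurableSpace α] [TopologicalSpace β] [MeasurableSpace β] [OpensMeasurableSpace β]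
    {P : Kernel α β} [IsMarkovKernel P]
    (hP : Continuous (Y := ProbabilityMeasure β) fun a => ⟨P a, inferInstance⟩) :
    Continuous (X := ProbabilityMeasure α) (Y := ProbabilityMeasure β)
      fun μ => ⟨(μ : Measure α).bind P, inferInstance⟩ := by
  refine ProbabilityMeasure.continuous_iff_forall_continuous_integral.2 fun f => ?_
  let Pf : BoundedContinuousFunction α ℝ := .ofNormedAddCommGroup (fun a => ∫ b, f b ∂P a)
    ((ProbabilityMeasure.continuous_integral_boundedContinuousFunction f).comp hP) ‖f‖
    fun a => f.norm_integral_le_norm (P a)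
  have hbind (μ : ProbabilityMeasure α) :
      ∫ b, f b ∂(μ : Measure α).bind P = ∫ a, Pf a ∂(μ : Measure α) := by
    rw [Measure.comp_eq_comp_const_apply, Kernel.integral_comp, Kernel.const_apply]
    · rfl
    · rw [← Measure.comp_eq_comp_const_apply]
      exact f.integrable _
  simpa only [ProbabilityMeasure.coe_mk, hbind] using
    ProbabilityMeasure.continuous_integral_boundedContinuousFunction Pf

variable {E : Type*} [PseudoMetricSpace E] [SecondCountableTopology E] [MeasurableSpace E]
  [OpensMeasurableSpace E] {P : Kernel E E} [IsMarkovKernel P] {Q : Kernel (E × E) (E × E)}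

theorem IsCouplingKernel.continuous (hQ : IsCouplingKernel Q P)
    (hcontr : ∀ p, ∫⁻ z, edist z.1 z.2 ∂Q p ≤ edist p.1 p.2) :
    Continuous (Y := ProbabilityMeasure E) fun x => ⟨P x, inferInstance⟩ := by
  have hLP : Continuous (Y := LevyProkhorov (ProbabilityMeasure E))
      fun x => .ofMeasure ⟨P x, inferInstance⟩ := by
    refine continuous_iff_continuousAt.2 fun x => tendsto_iff_edist_tendsto_0.2 ?_
    have hlim : Tendsto (fun y => edist y x ^ (1 / 2 : ℝ)) (𝓝 x) (𝓝 0) := by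
      have hedist := (continuous_id.edist (continuous_const (y := x))).tendsto x
      simpa using hedist.ennrpow_const (1 / 2)
    refine tendsto_of_tendsto_of_tendsto_of_le_of_le tendsto_const_nhds hlim
      (fun _ => zero_le) fun y => ?_
    exact (hQ.isCoupling y x).levyProkhorovEDist_le.trans
      (ENNReal.rpow_le_rpow (hcontr (y, x)) (by norm_num))
  exact LevyProkhorov.continuous_toMeasure_probabilityMeasure.comp hLP

theorem invariant_of_tendsto {E : Type*} [MetricSpace E] [SecondCountableTopology E]
    [MeasurableSpace E] [BorelSpace E] {P : Kernel E E} [IsMarkovKernel P]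
    (hP : Continuous (Y := ProbabilityMeasure E) fun x => ⟨P x, inferInstance⟩)
    {ι : Type*} {l : Filter ι} [l.NeBot] {ν : ι → ProbabilityMeasure E} {π : ProbabilityMeasure E}
    (hν : Tendsto ν l (𝓝 π))
    (hνP : Tendsto (fun i => levyProkhorovEDist (ν i : Measure E) ((ν i : Measure E).bind P)) l
      (𝓝 0)) : Kernel.Invariant P π := by
  have hcont := LevyProkhorov.continuous_ofMeasure_probabilityMeasure (Ω := E)
  have hedist := ((hcont.tendsto _).comp hν).edist
    ((hcont.tendsto _).comp (((continuous_bind_of_continuous hP).tendsto π).comp hν))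
  have heq := edist_eq_zero.1 (tendsto_nhds_unique hedist hνP)
  exact congrArg (fun μ => (μ.toMeasure : Measure E)) heq.symm

end Feller

theorem tendsto_ofReal_mul_log_div (C : ℝ) :
    Tendsto (fun m : ℕ => ENNReal.ofReal (C * (Real.log m / m))) atTop (𝓝 0) := by
  have h := Real.isLittleO_log_id_atTop.tendsto_div_nhds_zero.comp tendsto_natCast_atTop_atTop
  simpa using ENNReal.tendsto_ofReal (h.const_mul C)

section CauchySeq

variable {E : Type*} [PseudoMetricSpace E] [SecondCountableTopology E] [MeasurableSpace E]
  [OpensMeasurableSpace E] {P : Kernel E E} [IsMarkovKernel P] {Q : Kernel (E × E) (E × E)}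

theorem IsCouplingKernel.cauchySeq_pow (hQ : IsCouplingKernel Q P)
    (hcontr : ∀ p, ∫⁻ z, edist z.1 z.2 ∂Q p ≤ edist p.1 p.2)
    (hlim : ∀ p, Tendsto (fun m => ∫⁻ z, edist z.1 z.2 ∂(Q ^ m) p) atTop (𝓝 0))
    {x : E} (hfin : ∀ j, ∫⁻ y, edist x y ∂(P ^ j) x ≠ ∞)
    {n : ℕ → ℕ} (hn : Tendsto n atTop atTop)
    (hunif : Tendsto (fun m => ⨆ k, ∫⁻ y, ∫⁻ z, edist z.1 z.2 ∂(Q ^ m) (x, y) ∂(P ^ n k) x)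
      atTop (𝓝 0)) :
    CauchySeq (α := LevyProkhorov (ProbabilityMeasure E))
      fun k => .ofMeasure ⟨(P ^ n k) x, inferInstance⟩ := by
  let ν (m : ℕ) : LevyProkhorov (ProbabilityMeasure E) := .ofMeasure ⟨(P ^ m) x, inferInstance⟩
  refine EMetric.cauchySeq_iff.2 fun δ hδ => ?_
  have hδ4 : 0 < δ / 2 / 2 := ENNReal.half_pos (ENNReal.half_pos hδ.ne').ne'
  obtain ⟨m, hm⟩ : ∃ m, ∀ k, edist (ν m) (ν (n k + m)) < δ / 2 / 2 := by
    have hsqrt := hunif.ennrpow_const (1 / 2)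
    rw [ENNReal.zero_rpow_of_pos (by norm_num)] at hsqrt
    obtain ⟨m, hm⟩ := (hsqrt.eventually_lt_const hδ4).exists
    refine ⟨m, fun k => (hQ.levyProkhorovEDist_pow_le m (n k) x).trans_lt (hm.trans_le' ?_)⟩
    gcongr
    exact le_iSup (fun k => ∫⁻ y, ∫⁻ z, edist z.1 z.2 ∂(Q ^ m) (x, y) ∂(P ^ n k) x) k
  have hclose : ∀ᶠ k in atTop, edist (ν (n k)) (ν m) < δ / 2 := by
    filter_upwards [((hQ.tendsto_levyProkhorovEDist_pow hcontr hlim (hfin m)).comp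
      hn).eventually_lt_const hδ4] with k hk
    calc edist (ν (n k)) (ν m)
        ≤ edist (ν (n k)) (ν (m + n k)) + edist (ν m) (ν (n k + m)) := by
          rw [add_comm m, edist_comm (ν m)]
          exact edist_triangle _ _ _
      _ < δ / 2 / 2 + δ / 2 / 2 := ENNReal.add_lt_add hk (hm k)
      _ = δ / 2 := ENNReal.add_halves _
  obtain ⟨N, hN⟩ := eventually_atTop.1 hclose
  refine ⟨N, fun k hk l hl => ?_⟩
  calc edist (ν (n k)) (ν (n l)) ≤ edist (ν (n k)) (ν m) + edist (ν (n l)) (ν m) :=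
        edist_triangle_right _ _ _
    _ < δ / 2 + δ / 2 := ENNReal.add_lt_add (hN k hk) (hN l hl)
    _ = δ := ENNReal.add_halves δ

end CauchySeq

section InvariantMeasure

variable {E : Type*} [MetricSpace E] [SecondCountableTopology E] [MeasurableSpace E]
  [BorelSpace E] {P : Kernel E E} [IsMarkovKernel P] {Q : Kernel (E × E) (E × E)}

theorem IsCouplingKernel.invariant_unique (hQ : IsCouplingKernel Q P)
    (hcontr : ∀ p, ∫⁻ z, edist z.1 z.2 ∂Q p ≤ edist p.1 p.2)
    (hlim : ∀ p, Tendsto (fun m => ∫⁻ z, edist z.1 z.2 ∂(Q ^ m) p) atTop (𝓝 0))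
    {π π' : ProbabilityMeasure E} (hπ : Kernel.Invariant P π) (hπ' : Kernel.Invariant P π')
    (hfin : ∫⁻ z, edist z.1 z.2 ∂(π : Measure E).prod π' ≠ ∞) : π = π' := by
  have hle (m : ℕ) : levyProkhorovEDist (π : Measure E) π' ≤
      (∫⁻ p, ∫⁻ z, edist z.1 z.2 ∂(Q ^ m) p ∂(π : Measure E).prod π') ^ (1 / 2 : ℝ) := by
    have h := (hQ.pow m).levyProkhorovEDist_bind_le (isCoupling_prod (π : Measure E) π')
    rwa [(invariant_kernel_pow hπ m).def, (invariant_kernel_pow hπ' m).def] at h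
  have hzero : levyProkhorovEDist (π : Measure E) π' ≤ 0 := by
    refine ge_of_tendsto' (x := atTop) ?_ hle
    simpa using (tendsto_lintegral_lintegral_kernel_pow measurable_edist hcontr hlim
      hfin).ennrpow_const (1 / 2)
  have heq : LevyProkhorov.ofMeasure π = LevyProkhorov.ofMeasure π' := edist_le_zero.1 hzero
  exact congrArg LevyProkhorov.toMeasure heq

theorem IsCouplingKernel.exists_invariant [CompleteSpace E] (hQ : IsCouplingKernel Q P)
    (hcontr : ∀ p, ∫⁻ z, edist z.1 z.2 ∂Q p ≤ edist p.1 p.2)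
    (hlim : ∀ p, Tendsto (fun m => ∫⁻ z, edist z.1 z.2 ∂(Q ^ m) p) atTop (𝓝 0))
    {x : E} (hfin : ∀ j, ∫⁻ y, edist x y ∂(P ^ j) x ≠ ∞)
    {n : ℕ → ℕ} (hn : Tendsto n atTop atTop)
    (hunif : Tendsto (fun m => ⨆ k, ∫⁻ y, ∫⁻ z, edist z.1 z.2 ∂(Q ^ m) (x, y) ∂(P ^ n k) x)
      atTop (𝓝 0)) :
    ∃ π : ProbabilityMeasure E, Kernel.Invariant P π := by
  obtain ⟨π, hπ⟩ :=
    cauchySeq_tendsto_of_complete (hQ.cauchySeq_pow hcontr hlim hfin hn hunif)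
  refine ⟨π.toMeasure, invariant_of_tendsto (hQ.continuous hcontr)
    ((LevyProkhorov.continuous_toMeasure_probabilityMeasure.tendsto π).comp hπ) ?_⟩
  have hbind (m : ℕ) : ((P ^ m) x).bind P = (P ^ (1 + m)) x := by
    rw [add_comm, ← bind_kernel_pow_apply, pow_one]
  simp only [Function.comp_apply, ProbabilityMeasure.coe_mk, hbind]
  exact (hQ.tendsto_levyProkhorovEDist_pow hcontr hlim (hfin 1)).comp hn

theorem IsCouplingKernel.existsUnique_invariant [CompleteSpace E] (hQ : IsCouplingKernel Q P)
    (hd : ∀ x y : E, edist x y ≤ 1) (hcontr : ∀ p, ∫⁻ z, edist z.1 z.2 ∂Q p ≤ edist p.1 p.2)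
    {V : E × E → ℝ≥0} (hV : Measurable V) {c : ℕ → ℝ≥0∞} (hc : Tendsto c atTop (𝓝 0))
    (hrate : ∀ᶠ m in atTop, ∀ p, ∫⁻ z, edist z.1 z.2 ∂(Q ^ m) p ≤ c m * V p)
    {x : E} {n : ℕ → ℕ} (hn : Tendsto n atTop atTop)
    (htight : ∀ δ : ℝ≥0∞, 0 < δ → ∃ R : ℝ≥0, ∀ k, (P ^ n k) x {y | R < V (x, y)} ≤ δ) :
    ∃! π : Measure E, IsProbabilityMeasure π ∧ Kernel.Invariant P π := by
  have hmarkov := hQ.isMarkov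
  have hlim (p : E × E) : Tendsto (fun m => ∫⁻ z, edist z.1 z.2 ∂(Q ^ m) p) atTop (𝓝 0) := by
    have hcp : Tendsto (fun m => c m * V p) atTop (𝓝 0) := by
      simpa using ENNReal.Tendsto.mul_const hc (Or.inr (ENNReal.coe_ne_top (r := V p)))
    exact tendsto_of_tendsto_of_tendsto_of_le_of_le' tendsto_const_nhds hcp
      (.of_forall fun _ => zero_le) (hrate.mono fun m hm => hm p)
  have hunif := tendsto_iSup_lintegral_of_le_mul (hV.comp measurable_prodMk_left) htight
    (g := fun m y => ∫⁻ z, edist z.1 z.2 ∂(Q ^ m) (x, y))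
    (fun _ _ => lintegral_le_const (ae_of_all _ fun z => hd z.1 z.2)) hc
    (hrate.mono fun m hm y => hm (x, y))
  have hfin {α : Type _} [MeasurableSpace α] (μ : Measure α) [IsProbabilityMeasure μ]
      (f g : α → E) : ∫⁻ a, edist (f a) (g a) ∂μ ≠ ∞ :=
    ((lintegral_le_const (ae_of_all _ fun a => hd (f a) (g a))).trans_lt ENNReal.one_lt_top).ne
  obtain ⟨π, hπ⟩ := hQ.exists_invariant hcontr hlim (fun _ => hfin _ _ _) hn hunif
  refine ⟨π, ⟨inferInstance, hπ⟩, ?_⟩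
  rintro ρ ⟨hρ_prob, hρ⟩
  obtain ⟨ρ, rfl⟩ : ∃ ρ' : ProbabilityMeasure E, (ρ' : Measure E) = ρ := ⟨⟨ρ, hρ_prob⟩, rfl⟩
  exact congrArg _ (hQ.invariant_unique hcontr hlim hρ hπ (hfin _ _ _))

end InvariantMeasure

theorem mainTheorem1_general {E : Type*} [MetricSpace E] [CompleteSpace E]
    [SecondCountableTopology E] [MeasurableSpace E] [BorelSpace E]
    (hd : ∀ x y : E, dist x y ≤ 1)
    (P : Kernel E E) [IsMarkovKernel P]
    (Q : Kernel (E × E) (E × E)) (hQ : IsCouplingKernel Q P)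
    (Δ : Set (E × E)) (ℓ : ℕ) (hℓ : 1 ≤ ℓ) (ε : ℝ) (hε : 0 < ε)
    (hcontr : ContractionCondition Q Δ ℓ ε)
    (𝒱 : E × E → ℝ≥0) (h𝒱 : Measurable 𝒱) (h𝒱_one : ∀ p, 1 ≤ 𝒱 p) (b : ℝ≥0)
    (hdrift : DriftCondition Q Δ ℓ 𝒱 b)
    (x₀ : E) (n : ℕ → ℕ) (hn : Tendsto n atTop atTop)
    (h𝒱_tight : ∀ δ : ℝ≥0∞, 0 < δ → ∃ R : ℝ≥0, ∀ k, (P ^ n k) x₀ {y | R < 𝒱 (x₀, y)} ≤ δ) :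
    (∃! π : Measure E, IsProbabilityMeasure π ∧ Kernel.Invariant P π) ∧
    ∃ C : ℝ, ∀ m : ℕ, 2 ≤ m → ∀ x y : E,
      ∫ z, dist z.1 z.2 ∂((Q ^ m) (x, y)) ≤ C * (Real.log m / m) * 𝒱 (x, y) := by
  have hmarkov := hQ.isMarkov
  obtain ⟨C, hC⟩ := exists_integral_dist_pow_le hd hℓ hε hcontr h𝒱 h𝒱_one hdrift
  refine ⟨?_, C, fun m hm x y => hC m hm (x, y)⟩
  have hrate : ∀ᶠ m : ℕ in atTop, ∀ p, ∫⁻ z, edist z.1 z.2 ∂(Q ^ m) p ≤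
      ENNReal.ofReal (C * (Real.log m / m)) * 𝒱 p := by
    filter_upwards [eventually_ge_atTop 2] with m hm p
    rw [← ofReal_integral_dist hd, ← ENNReal.ofReal_coe_nnreal, ← ENNReal.ofReal_mul' (by simp)]
    exact ENNReal.ofReal_le_ofReal (hC m hm p)
  exact hQ.existsUnique_invariant (fun x y => by simpa [edist_dist] using hd x y)
    (hcontr.lintegral_edist_le hd) h𝒱 (tendsto_ofReal_mul_log_div C) hrate hn h𝒱_tight

theorem mainTheorem1 {E : Type*} [MetricSpace E] [CompleteSpace E] [SecondCountableTopology E]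
    [MeasurableSpace E] [BorelSpace E]
    (hd : ∀ x y : E, dist x y ≤ 1)
    (P : Kernel E E) [IsMarkovKernel P]
    (Q : Kernel (E × E) (E × E)) (hQ : IsCouplingKernel Q P)
    (Δ : Set (E × E)) (hΔ : MeasurableSet Δ) (ℓ : ℕ) (hℓ : 1 ≤ ℓ) (ε : ℝ) (hε : 0 < ε)
    (hcontr : ContractionCondition Q Δ ℓ ε)
    (𝒱 : E × E → ℝ≥0) (h𝒱 : Measurable 𝒱) (h𝒱_one : ∀ p, 1 ≤ 𝒱 p) (b : ℝ≥0)
    (hdrift : DriftCondition Q Δ ℓ 𝒱 b)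
    (ψ : ℝ≥0 → ℝ≥0) (hψ_anti : AntitoneOn (fun v => ψ v / v) (Set.Ioi 0))
    (hψ_top : Tendsto ψ atTop atTop)
    (x₀ : E) (n : ℕ → ℕ) (hn : Tendsto n atTop atTop)
    (hψ_bdd : ⨆ k, ∫⁻ y, (ψ (𝒱 (x₀, y)) : ℝ≥0∞) ∂((P ^ n k) x₀) < ∞) :
    (∃! π : Measure E, IsProbabilityMeasure π ∧ Kernel.Invariant P π) ∧
    ∃ C : ℝ, ∀ m : ℕ, 2 ≤ m → ∀ x y : E,
      ∫ z, dist z.1 z.2 ∂((Q ^ m) (x, y)) ≤ C * (Real.log m / m) * 𝒱 (x, y) :=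
  mainTheorem1_general hd P Q hQ Δ ℓ hℓ ε hε hcontr 𝒱 h𝒱 h𝒱_one b hdrift x₀ n hn fun _ =>
    exists_forall_measure_lt_le_of_iSup_lintegral_lt_top (h𝒱.comp measurable_prodMk_left)
      hψ_top hψ_bdd
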